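/- A \emph{pseudoline} in the Euclidean plane $\mathbb{E}=\mathbb{R}^2$ is the image of a straight line under a homeomorphism of the plane onto itself. A \emph{Euclidean arrangement of pseudolines} is a finite collection $\mathcal{L}$ of pseudolines in $\mathbb{E}$, any two of which have exactly one common point and cross there; it is \emph{simple} if no point belongs to more than two of its pseudolines. The \emph{cells} of $\mathcal{L}$ are the connected components of $\mathbb{E}\setminus\bigcup_{p\in\mathcal{L}}p$, and the \emph{polygons} of $\mathcal{L}$ are its bounded cells. The \emph{edges} of $\mathcal{L}$ on a pseudoline $p\in\mathcal L$ are the connected components of $p\setminus\bigcup_{q\in\mathcal{L},\,q\ne p}q$. An edge $e$ of $\mathcal{L}$ is an edge of a cell $C$ (and $e$, as well as the pseudoline containing $e$, is \emph{adjacent} to $C$) if $e\subseteq\overline{C}$. A \emph{triangle}, a \emph{quadrilateral}, a \emph{$(\ge 5)$-gon} is a polygon with exactly three, exactly four, at least five edges, respectively. An edge of a polygon $Q$ of $\mathcal{L}$ is a \emph{critical edge} of $Q$ if it is adjacent to an unbounded cell of $\mathcal{L}$. Let $\Im$ be the set of simple Euclidean arrangements of pseudolines in which all polygons except exactly one, which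 is a $(\ge 5)$-gon, are triangles or quadrilaterals, and in which every pseudoline is adjacent to this unique $(\ge 5)$-gon. \textbf{Proposition.} If $\mathcal{L}\in\Im$, then every edge of the $(\ge 5)$-gon of $\mathcal{L}$ that is not a critical edge of it is also an edge of a triangle of $\mathcal{L}$. -/

import Mathlib

namespace PseudoArr

/-- The Euclidean plane. -/
abbrev Plane : Type := EuclideanSpace ℝ (Fin 2)

/-- A pseudoline in the Euclidean plane: the image of a straight line (without loss of generality
the first coordinate axis) under a homeomorphism of the plane onto itself. -/
def IsPseudoline (p : Set Plane) : Prop :=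
  ∃ h : Plane ≃ₜ Plane, p = h '' {x : Plane | x 1 = 0}

/-- The curve `q` passes from one side of `p` to another: it has points in two different connected
components of the complement of `p`. For two pseudolines with exactly one common point this says
that they cross at that point. -/
def Crosses (p q : Set Plane) : Prop :=
  ∃ a ∈ q \ p, ∃ b ∈ q \ p, connectedComponentIn pᶜ a ≠ connectedComponentIn pᶜ b

/-- A Euclidean arrangement of pseudolines: a finite collection of pseudolines in the plane, any
two of which have exactly one common point and cross there. -/
structure IsArrangement (L : Finset (Set Plane)) : Prop where
  isPseudoline : ∀ p ∈ L, IsPseudoline p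
  inter_eq : ∀ p ∈ L, ∀ q ∈ L, p ≠ q → ∃ v : Plane, p ∩ q = {v}
  crosses : ∀ p ∈ L, ∀ q ∈ L, p ≠ q → Crosses p q

/-- No point belongs to more than two pseudolines of the collection. -/
def IsSimple (L : Finset (Set Plane)) : Prop :=
  ∀ p ∈ L, ∀ q ∈ L, ∀ r ∈ L, p ≠ q → p ≠ r → q ≠ r → p ∩ q ∩ r = ∅

/-- The (open two-dimensional) cells: the connected components of the complement of the union of
all pseudolines. -/
def IsCell (L : Finset (Set Plane)) (C : Set Plane) : Prop :=
  ∃ x ∈ (⋃ p ∈ L, p)ᶜ, C = connectedComponentIn (⋃ p ∈ L, p)ᶜ x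

/-- The part of `p` that lies on no other pseudoline of the collection. -/
def privatePart (L : Finset (Set Plane)) (p : Set Plane) : Set Plane :=
  p \ ⋃ q ∈ L, ⋃ _ : q ≠ p, q

/-- `e` is an (open) edge of the arrangement lying on the pseudoline `p`: a connected component of
what remains of `p` after its crossings with the other pseudolines are removed. -/
def IsEdgeOn (L : Finset (Set Plane)) (p e : Set Plane) : Prop :=
  p ∈ L ∧ ∃ x ∈ privatePart L p, e = connectedComponentIn (privatePart L p) x

/-- `e` is an edge of the arrangement that is adjacent to the cell `C`, i.e. an edge of `C`. -/
def IsEdgeOf (L : Finset (Set Plane)) (e C : Set Plane) : Prop :=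
  (∃ p, IsEdgeOn L p e) ∧ e ⊆ closure C

/-- A polygon of the arrangement: a bounded cell. -/
def IsPolygon (L : Finset (Set Plane)) (C : Set Plane) : Prop :=
  IsCell L C ∧ Bornology.IsBounded C

/-- The number of edges of a cell. -/
noncomputable def numEdges (L : Finset (Set Plane)) (C : Set Plane) : ℕ∞ :=
  {e | IsEdgeOf L e C}.encard

/-- A polygon with exactly `k` edges. -/
def IsGon (L : Finset (Set Plane)) (k : ℕ) (C : Set Plane) : Prop :=
  IsPolygon L C ∧ numEdges L C = k

/-- A polygon with at least five edges. -/
def IsGeFiveGon (L : Finset (Set Plane)) (C : Set Plane) : Prop :=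
  IsPolygon L C ∧ 5 ≤ numEdges L C

/-- Every polygon except one, which has at least five edges, is a triangle or a quadrilateral. -/
def HasOneGeFiveGon (L : Finset (Set Plane)) : Prop :=
  ∃ P, IsGeFiveGon L P ∧ ∀ Q, IsPolygon L Q → Q ≠ P → IsGon L 3 Q ∨ IsGon L 4 Q

/-- The pseudoline `p` is adjacent to the cell `C`: it contains an edge of `C`. -/
def IsAdjacent (L : Finset (Set Plane)) (p C : Set Plane) : Prop :=
  ∃ e, IsEdgeOn L p e ∧ IsEdgeOf L e C

/-- The class of simple Euclidean arrangements of pseudolines with one polygon with at least five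
edges, in which every pseudoline is adjacent to that polygon. -/
structure IsInIm (L : Finset (Set Plane)) : Prop where
  isArrangement : IsArrangement L
  isSimple : IsSimple L
  hasOne : HasOneGeFiveGon L
  adjacent : ∀ P, IsGeFiveGon L P → ∀ p ∈ L, IsAdjacent L p P

/-- `e` is a critical edge of `Q`: an edge of `Q` that is adjacent to an unbounded cell. -/
def IsCriticalEdge (L : Finset (Set Plane)) (e Q : Set Plane) : Prop :=
  IsEdgeOf L e Q ∧ ∃ C, IsCell L C ∧ ¬ Bornology.IsBounded C ∧ IsEdgeOf L e C

end PseudoArr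

namespace PseudoArr

open Set Topology

/-! Let `e`, on the pseudoline `p`, be an edge of the (≥5)-gon `P`, and let `C` be the cell across
`e` (`IsEdgeOn.exists_opposite_cell`). As `e` is not critical, `C` is bounded, so it is a triangle
or a quadrilateral; the point is to exclude four edges (`numEdges_ne_four`). Only `p` separates `C`
from `P`, since both closures contain `e`. Another edge of `C` lies on some `r ≠ p`
(`IsCell.edge_unique`), and `r` also carries an edge of `P`. Walking along `r` from the former to
the latter, one must cross `p` and can cross nothing else, so the crossing of `r` and `p` is a
vertex of `C` (`exists_vertex_mem_closure`). Four edges would thus give three vertices of `C` on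
`p`, but the pseudoline through the middle one would separate the other two
(`IsCell.not_three_vertices`). -/

/-! ### Pseudolines and their sides -/

lemma IsPseudoline.isClosed {p : Set Plane} (hp : IsPseudoline p) : IsClosed p := by
  obtain ⟨h, rfl⟩ := hp
  refine h.isClosedMap _ ?_
  exact isClosed_eq (by fun_prop) continuous_const

/-- A pseudoline is an injective continuous image of the real line. -/
lemma IsPseudoline.exists_param {p : Set Plane} (hp : IsPseudoline p) :
    ∃ φ : ℝ → Plane, Continuous φ ∧ Function.Injective φ ∧ range φ = p := by
  obtain ⟨h, rfl⟩ := hp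
  refine ⟨fun t => h !₂[t, 0], ?_, ?_, ?_⟩
  · refine h.continuous.comp ((PiLp.continuous_toLp 2 _).comp ?_)
    refine continuous_pi fun i => ?_
    fin_cases i
    · exact continuous_id
    · exact continuous_const
  · intro a b hab
    simpa using congrArg (fun x : Plane => x 0) (h.injective hab)
  · ext y
    constructor
    · rintro ⟨t, rfl⟩
      exact mem_image_of_mem _ (by simp)
    · rintro ⟨x, hx, rfl⟩
      refine ⟨x 0, congrArg h ?_⟩
      ext i
      fin_cases i
      · simp
      · simpa using (show x 1 = 0 from hx).symm

/-- Two points are separated by `p`. -/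
def Separates (p : Set Plane) (a b : Plane) : Prop :=
  connectedComponentIn pᶜ a ≠ connectedComponentIn pᶜ b

/-- A connected set that avoids `p` lies on the same side of `p` as the points of its closure
off `p`. -/
lemma component_eq_of_mem_closure {p C : Set Plane} (hp : IsClosed p) (hC : IsPreconnected C)
    (hCp : C ⊆ pᶜ) {x c : Plane} (hx : x ∈ closure C) (hxp : x ∉ p) (hc : c ∈ C) :
    connectedComponentIn pᶜ x = connectedComponentIn pᶜ c := by
  have hopen : IsOpen (connectedComponentIn pᶜ x) := hp.isOpen_compl.connectedComponentIn
  obtain ⟨y, hy, hyC⟩ := mem_closure_iff.1 hx _ hopen (mem_connectedComponentIn hxp)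
  rw [connectedComponentIn_eq hy]
  exact connectedComponentIn_eq (hC.subset_connectedComponentIn hyC hCp hc)

lemma component_eq_of_uIcc {p : Set Plane} {φ : ℝ → Plane} (hφ : Continuous φ) {a b : ℝ}
    (h : ∀ t ∈ uIcc a b, φ t ∉ p) :
    connectedComponentIn pᶜ (φ a) = connectedComponentIn pᶜ (φ b) := by
  refine connectedComponentIn_eq ?_
  refine (isPreconnected_uIcc.image φ hφ.continuousOn).subset_connectedComponentIn
    (mem_image_of_mem _ left_mem_uIcc) ?_ (mem_image_of_mem _ right_mem_uIcc)
  rintro _ ⟨t, ht, rfl⟩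
  exact h t ht

/-- A curve that crosses `p` in a single point has its two ends on different sides of `p`. -/
lemma Crosses.separates {p q : Set Plane} (hc : Crosses p q) {φ : ℝ → Plane} (hφ : Continuous φ)
    (hφq : range φ = q) {d : ℝ} (hd : ∀ t, φ t ∈ p → t = d) {a b : ℝ} (ha : a < d) (hb : d < b) :
    Separates p (φ a) (φ b) := by
  obtain ⟨x, ⟨hxq, hxp⟩, y, ⟨hyq, hyp⟩, hxy⟩ := hc
  rw [← hφq] at hxq hyq
  obtain ⟨s, rfl⟩ := hxq
  obtain ⟨t, rfl⟩ := hyq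
  have low : ∀ u v, u < d → v < d →
      connectedComponentIn pᶜ (φ u) = connectedComponentIn pᶜ (φ v) := fun u v hu hv =>
    component_eq_of_uIcc hφ fun t ht htp => by
      have := ht.2
      rw [hd t htp] at this
      exact absurd this (not_le.2 (max_lt hu hv))
  have high : ∀ u v, d < u → d < v →
      connectedComponentIn pᶜ (φ u) = connectedComponentIn pᶜ (φ v) := fun u v hu hv =>
    component_eq_of_uIcc hφ fun t ht htp => by
      have := ht.1
      rw [hd t htp] at this
      exact absurd this (not_le.2 (lt_min hu hv))
  -- `hd` does not assert that the curve meets `p` at `d`; if it does not, the whole curve avoids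
  -- `p` and cannot cross it.
  by_cases hdp : φ d ∈ p
  · have hs : s ≠ d := fun h => hxp (h ▸ hdp)
    have ht : t ≠ d := fun h => hyp (h ▸ hdp)
    intro hab
    rcases lt_or_gt_of_ne hs with hs | hs <;> rcases lt_or_gt_of_ne ht with ht | ht
    · exact hxy (low _ _ hs ht)
    · exact hxy ((low _ _ hs ha).trans (hab.trans (high _ _ hb ht)))
    · exact hxy ((high _ _ hs hb).trans (hab.symm.trans (low _ _ ha ht)))
    · exact hxy (high _ _ hs ht)
  · refine absurd (component_eq_of_uIcc hφ fun u _ hu => hdp ?_) hxy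
    rwa [← hd u hu]

/-! ### Cells -/

variable {L : Finset (Set Plane)}

lemma isClosed_iUnion_of_ne (hL : IsArrangement L) (p : Set Plane) :
    IsClosed (⋃ q ∈ L, ⋃ _ : q ≠ p, q) := by
  refine L.finite_toSet.isClosed_biUnion fun q hq => ?_
  exact isClosed_iUnion_of_finite fun _ => (hL.isPseudoline q hq).isClosed

lemma notMem_of_mem_privatePart {p q : Set Plane} (hq : q ∈ L) (hqp : q ≠ p) {x : Plane}
    (hx : x ∈ privatePart L p) : x ∉ q := fun h => hx.2 (by simp only [mem_iUnion]; exact ⟨q, hq, hqp, h⟩)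

lemma IsCell.isPreconnected {C : Set Plane} (hC : IsCell L C) : IsPreconnected C := by
  obtain ⟨x, -, rfl⟩ := hC
  exact isPreconnected_connectedComponentIn

lemma IsCell.subset_compl {C p : Set Plane} (hC : IsCell L C) (hp : p ∈ L) : C ⊆ pᶜ := by
  obtain ⟨x, -, rfl⟩ := hC
  exact (connectedComponentIn_subset _ _).trans (compl_subset_compl.2 (subset_biUnion_of_mem (u := id) hp))

lemma IsCell.nonempty {C : Set Plane} (hC : IsCell L C) : C.Nonempty := by
  obtain ⟨x, hx, rfl⟩ := hC
  exact ⟨x, mem_connectedComponentIn hx⟩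

lemma IsCell.eq_of_mem {C : Set Plane} (hC : IsCell L C) {x : Plane} (hx : x ∈ C) :
    C = connectedComponentIn (⋃ p ∈ L, p)ᶜ x := by
  obtain ⟨y, -, rfl⟩ := hC
  exact connectedComponentIn_eq hx

lemma IsCell.subset_of_isPreconnected {C A : Set Plane} (hC : IsCell L C) (hA : IsPreconnected A)
    (hAL : A ⊆ (⋃ p ∈ L, p)ᶜ) {x : Plane} (hxA : x ∈ A) (hxC : x ∈ C) : A ⊆ C := by
  rw [hC.eq_of_mem hxC]
  exact hA.subset_connectedComponentIn hxA hAL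

/-- No pseudoline separates two points, off that pseudoline, of the closure of a cell. -/
lemma IsCell.not_separates {C p : Set Plane} (hL : IsArrangement L) (hC : IsCell L C) (hp : p ∈ L)
    {x y : Plane} (hx : x ∈ closure C) (hy : y ∈ closure C) (hxp : x ∉ p) (hyp : y ∉ p) :
    ¬ Separates p x y := by
  obtain ⟨c, hc⟩ := hC.nonempty
  have hcl := (hL.isPseudoline p hp).isClosed
  exact not_not.2 ((component_eq_of_mem_closure hcl hC.isPreconnected (hC.subset_compl hp) hx hxp hc).trans
    (component_eq_of_mem_closure hcl hC.isPreconnected (hC.subset_compl hp) hy hyp hc).symm)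

/-- Pulled back by `h`, the second coordinate is continuous and vanishes only on the pseudoline, so
by the intermediate value theorem it cannot change sign on a component of the complement. -/
lemma separates_of_pos_of_neg (h : Plane ≃ₜ Plane) {a b : Plane} (ha : 0 < a 1) (hb : b 1 < 0) :
    Separates (h '' {x | x 1 = 0}) (h a) (h b) := by
  intro hab
  set K := connectedComponentIn (h '' {x : Plane | x 1 = 0})ᶜ (h a)
  have hbK : h b ∈ K := hab ▸ mem_connectedComponentIn (by
    rintro ⟨x, hx, hxb⟩
    rw [h.injective hxb] at hx
    exact hb.ne hx)
  have haK : h a ∈ K := mem_connectedComponentIn (by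
    rintro ⟨x, hx, hxa⟩
    rw [h.injective hxa] at hx
    exact ha.ne' hx)
  have hK : IsPreconnected K := isPreconnected_connectedComponentIn
  have hcont : Continuous fun y : Plane => h.symm y 1 := by
    have : Continuous fun y : Plane => y 1 := by fun_prop
    exact this.comp h.symm.continuous
  obtain ⟨y, hyK, hy⟩ := hK.intermediate_value hbK haK hcont.continuousOn
    (show (0 : ℝ) ∈ Icc _ _ by simpa using ⟨hb.le, ha.le⟩)
  exact connectedComponentIn_subset _ _ hyK ⟨h.symm y, hy, h.apply_symm_apply y⟩

lemma mem_closure_halfSpace {y : Plane} (hy : y 1 = 0) (ε : ℝ) (hε : ε ≠ 0) :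
    y ∈ closure {x : Plane | 0 < ε * x 1} := by
  have hc : Filter.Tendsto (fun t : ℝ => y + t • !₂[0, ε]) (𝓝[>] 0) (𝓝 y) := by
    have : Continuous fun t : ℝ => y + t • (!₂[0, ε] : Plane) := by fun_prop
    have h0 := this.tendsto 0
    rw [zero_smul, add_zero] at h0
    exact h0.mono_left nhdsWithin_le_nhds
  refine mem_closure_of_tendsto hc ?_
  filter_upwards [self_mem_nhdsWithin] with t ht
  have ht' : 0 < t := ht
  have : 0 < t * (ε * ε) := mul_pos ht' (mul_self_pos.2 hε)
  simp only [PiLp.add_apply, PiLp.smul_apply, hy, smul_eq_mul]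
  simpa [mul_comm, mul_left_comm, mul_assoc] using this

/-! ### Cells on the two sides of an edge -/

/-- Near a point that lies on no other pseudoline, a pseudoline of an arrangement looks like a
diameter of a disc that is met by no other pseudoline. -/
lemma exists_local_sides (hL : IsArrangement L) {p : Set Plane} (hp : p ∈ L) {x : Plane}
    (hx : x ∈ privatePart L p) :
    ∃ W A B : Set Plane, IsOpen W ∧ x ∈ W ∧ IsPreconnected A ∧ IsPreconnected B ∧
      W \ p ⊆ A ∪ B ∧ A ⊆ (⋃ q ∈ L, q)ᶜ ∧ B ⊆ (⋃ q ∈ L, q)ᶜ ∧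
      W ∩ p ⊆ closure A ∧ W ∩ p ⊆ closure B ∧ ∀ a ∈ A, ∀ b ∈ B, Separates p a b := by
  obtain ⟨h, hh⟩ := hL.isPseudoline p hp
  have hxp := hx.1
  rw [hh] at hxp
  obtain ⟨x₀, hx₀, rfl⟩ := hxp
  have hU := (isClosed_iUnion_of_ne hL p).isOpen_compl.preimage h.continuous
  obtain ⟨ε, hε, hball⟩ := Metric.isOpen_iff.1 hU x₀ hx.2
  set D := Metric.ball x₀ ε
  have hDp : ∀ y ∈ D, y 1 ≠ 0 → h y ∈ (⋃ q ∈ L, q)ᶜ := by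
    intro y hy hy1 hmem
    simp only [mem_iUnion] at hmem
    obtain ⟨q, hq, hyq⟩ := hmem
    by_cases hqp : q = p
    · rw [hqp, hh] at hyq
      obtain ⟨z, hz, hzy⟩ := hyq
      exact hy1 (h.injective hzy ▸ hz)
    · exact hball hy (by simp only [mem_iUnion]; exact ⟨q, hq, hqp, hyq⟩)
  -- The sign of `δ` selects one of the two half-discs; `1` and `-1` are used below.
  have key : ∀ δ : ℝ, δ ≠ 0 → IsPreconnected (h '' (D ∩ {y | 0 < δ * y 1})) ∧
      h '' (D ∩ {y | 0 < δ * y 1}) ⊆ (⋃ q ∈ L, q)ᶜ ∧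
      h '' D ∩ p ⊆ closure (h '' (D ∩ {y | 0 < δ * y 1})) := by
    intro δ hδ
    refine ⟨?_, ?_, ?_⟩
    · refine IsPreconnected.image ?_ _ h.continuous.continuousOn
      refine ((convex_ball x₀ ε).inter ?_).isPreconnected
      refine convex_halfSpace_gt (f := fun y : Plane => δ * y 1) ⟨?_, ?_⟩ 0
      · intro u v; simp [mul_add]
      · intro c u; simp [mul_left_comm]
    · rintro _ ⟨y, ⟨hyD, hy⟩, rfl⟩
      refine hDp y hyD fun h0 => ?_
      simp [h0] at hy
    · rintro _ ⟨⟨y, hyD, rfl⟩, hyp⟩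
      rw [hh] at hyp
      obtain ⟨z, hz, hzy⟩ := hyp
      rw [← h.image_closure]
      refine mem_image_of_mem _ (Metric.isOpen_ball.inter_closure ⟨hyD, ?_⟩)
      exact mem_closure_halfSpace (h.injective hzy ▸ hz) δ hδ
  obtain ⟨a₁, a₂, a₃⟩ := key 1 one_ne_zero
  obtain ⟨b₁, b₂, b₃⟩ := key (-1) (by norm_num)
  refine ⟨h '' D, _, _, h.isOpenMap _ Metric.isOpen_ball,
    mem_image_of_mem _ (Metric.mem_ball_self hε), a₁, b₁, ?_, a₂, b₂, a₃, b₃, ?_⟩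
  · rintro _ ⟨⟨y, hyD, rfl⟩, hyp⟩
    have hy : y 1 ≠ 0 := fun h0 => hyp (hh ▸ mem_image_of_mem _ h0)
    rcases lt_or_gt_of_ne hy with hy | hy
    · exact Or.inr (mem_image_of_mem _ ⟨hyD, by simpa using hy⟩)
    · exact Or.inl (mem_image_of_mem _ ⟨hyD, by simpa using hy⟩)
  · rintro _ ⟨a, ⟨-, ha⟩, rfl⟩ _ ⟨b, ⟨-, hb⟩, rfl⟩
    rw [hh]
    exact separates_of_pos_of_neg h (by simpa using ha) (by simpa using hb)

/-- An edge that has a point in the closure of a cell is contained in it. -/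
lemma IsEdgeOn.subset_closure (hL : IsArrangement L) {p e C : Set Plane} (he : IsEdgeOn L p e)
    (hC : IsCell L C) {x : Plane} (hxe : x ∈ e) (hxC : x ∈ closure C) : e ⊆ closure C := by
  obtain ⟨hp, x₀, hx₀, rfl⟩ := he
  by_contra hne
  obtain ⟨y, hye, hyC⟩ := not_subset.1 hne
  -- `V` witnesses that membership in `closure C` is an open condition along `e`. It is also a
  -- closed one, so connectedness of `e` decides.
  set V := ⋃₀ {W : Set Plane | IsOpen W ∧ W ∩ p ⊆ closure C}
  have hV : IsOpen V := isOpen_sUnion fun W hW => hW.1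
  have hsub := connectedComponentIn_subset (privatePart L p) x₀
  have hin : ∀ z ∈ privatePart L p, z ∈ closure C → z ∈ V := by
    intro z hz hzC
    obtain ⟨W, A, B, hW, hzW, hA, hB, hAB, hAL, hBL, hWA, hWB, -⟩ := exists_local_sides hL hp hz
    obtain ⟨c, hcW, hcC⟩ := mem_closure_iff.1 hzC W hW hzW
    refine ⟨W, ⟨hW, ?_⟩, hzW⟩
    rcases hAB ⟨hcW, hC.subset_compl hp hcC⟩ with hc | hc
    · exact hWA.trans (closure_mono (hC.subset_of_isPreconnected hA hAL hc hcC))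
    · exact hWB.trans (closure_mono (hC.subset_of_isPreconnected hB hBL hc hcC))
  obtain ⟨z, hze, hzV, hzC⟩ := isPreconnected_connectedComponentIn V (closure C)ᶜ hV
    isClosed_closure.isOpen_compl
    (fun z hz => by
      by_cases hzC : z ∈ closure C
      · exact Or.inl (hin z (hsub hz) hzC)
      · exact Or.inr hzC)
    ⟨x, hxe, hin x (hsub hxe) hxC⟩ ⟨y, hye, hyC⟩
  obtain ⟨W, ⟨-, hW⟩, hzW⟩ := hzV
  exact hzC (hW ⟨hzW, (hsub hze).1⟩)

/-- The cell on the other side of an edge of a cell. -/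
lemma IsEdgeOn.exists_opposite_cell (hL : IsArrangement L) {p e P : Set Plane}
    (he : IsEdgeOn L p e) (hP : IsCell L P) (heP : e ⊆ closure P) :
    ∃ C, IsCell L C ∧ e ⊆ closure C ∧ ∃ a ∈ C, ∃ b ∈ P, Separates p a b := by
  obtain ⟨hp, x, hx, hex⟩ := id he
  have hxe : x ∈ e := hex ▸ mem_connectedComponentIn hx
  obtain ⟨W, A, B, hW, hxW, hA, hB, hAB, hAL, hBL, hWA, hWB, hsep⟩ := exists_local_sides hL hp hx
  have main : ∀ A : Set Plane, IsPreconnected A → A ⊆ (⋃ q ∈ L, q)ᶜ → W ∩ p ⊆ closure A →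
      ∃ C, IsCell L C ∧ e ⊆ closure C ∧ ∃ a ∈ C, a ∈ A := by
    intro A hA hAL hWA
    have hxA := hWA ⟨hxW, hx.1⟩
    obtain ⟨a, ha⟩ := closure_nonempty_iff.1 ⟨x, hxA⟩
    have hC : IsCell L (connectedComponentIn (⋃ q ∈ L, q)ᶜ a) := ⟨a, hAL ha, rfl⟩
    exact ⟨_, hC, he.subset_closure hL hC hxe
      (closure_mono (hA.subset_connectedComponentIn ha hAL) hxA), a,
      mem_connectedComponentIn (hAL ha), ha⟩
  obtain ⟨b, hbW, hbP⟩ := mem_closure_iff.1 (heP hxe) W hW hxW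
  -- `P` reaches one of the two half-discs; the opposite cell is the one containing the other.
  rcases hAB ⟨hbW, hP.subset_compl hp hbP⟩ with hb | hb
  · obtain ⟨C, hC, heC, a, haC, ha⟩ := main B hB hBL hWB
    exact ⟨C, hC, heC, a, haC, b, hbP, (hsep b hb a ha).symm⟩
  · obtain ⟨C, hC, heC, a, haC, ha⟩ := main A hA hAL hWA
    exact ⟨C, hC, heC, a, haC, b, hbP, hsep a ha b hb⟩

/-! ### Walking along a pseudoline -/

lemma IsEdgeOn.nonempty {p e : Set Plane} (he : IsEdgeOn L p e) : e.Nonempty := by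
  obtain ⟨-, x, hx, rfl⟩ := he
  exact ⟨x, mem_connectedComponentIn hx⟩

lemma IsEdgeOn.subset_privatePart {p e : Set Plane} (he : IsEdgeOn L p e) :
    e ⊆ privatePart L p := by
  obtain ⟨-, x, -, rfl⟩ := he
  exact connectedComponentIn_subset _ _

lemma IsEdgeOn.eq_of_mem {p e : Set Plane} (he : IsEdgeOn L p e) {x : Plane} (hx : x ∈ e) :
    e = connectedComponentIn (privatePart L p) x := by
  obtain ⟨-, y, -, rfl⟩ := he
  exact connectedComponentIn_eq hx

/-- If two pseudolines of an arrangement meet in a point strictly between two others on a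
parametrized pseudoline, those are separated. -/
lemma IsArrangement.separates (hL : IsArrangement L) {r s : Set Plane} (hr : r ∈ L) (hs : s ∈ L)
    (hrs : r ≠ s) {φ : ℝ → Plane} (hφ : Continuous φ) (hinj : Function.Injective φ)
    (hφr : range φ = r) {a b d : ℝ} (hd : φ d ∈ s) (hab : a < d ∧ d < b ∨ b < d ∧ d < a) :
    Separates s (φ a) (φ b) := by
  obtain ⟨v, hv⟩ := hL.inter_eq r hr s hs hrs
  have mem : ∀ t, φ t ∈ s → φ t = v := fun t ht =>
    mem_singleton_iff.1 (hv ▸ ⟨hφr ▸ mem_range_self t, ht⟩)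
  have huniq : ∀ t, φ t ∈ s → t = d := fun t ht => hinj ((mem t ht).trans (mem d hd).symm)
  have hcr := hL.crosses s hs r hr hrs.symm
  rcases hab with ⟨h₁, h₂⟩ | ⟨h₁, h₂⟩
  · exact hcr.separates hφ hφr huniq h₁ h₂
  · exact (hcr.separates hφ hφr huniq h₁ h₂).symm

lemma strictly_between_of_mem_uIcc {a b d : ℝ} (h : d ∈ uIcc a b) (ha : d ≠ a) (hb : d ≠ b) :
    a < d ∧ d < b ∨ b < d ∧ d < a := by
  rcases mem_uIcc.1 h with ⟨h₁, h₂⟩ | ⟨h₁, h₂⟩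
  · exact Or.inl ⟨lt_of_le_of_ne h₁ ha.symm, lt_of_le_of_ne h₂ hb⟩
  · exact Or.inr ⟨lt_of_le_of_ne h₁ hb.symm, lt_of_le_of_ne h₂ ha⟩

/-- A cell has at most one edge on each pseudoline. -/
lemma IsCell.edge_unique (hL : IsArrangement L) {C r e f : Set Plane} (hC : IsCell L C)
    (he : IsEdgeOn L r e) (hf : IsEdgeOn L r f) (heC : e ⊆ closure C) (hfC : f ⊆ closure C) :
    e = f := by
  obtain ⟨φ, hφ, hinj, hφr⟩ := (hL.isPseudoline r he.1).exists_param
  obtain ⟨x, hx⟩ := he.nonempty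
  obtain ⟨y, hy⟩ := hf.nonempty
  have hxr := he.subset_privatePart hx
  have hyr := hf.subset_privatePart hy
  obtain ⟨a, rfl⟩ : x ∈ range φ := hφr ▸ hxr.1
  obtain ⟨b, rfl⟩ : y ∈ range φ := hφr ▸ hyr.1
  rw [he.eq_of_mem hx, hf.eq_of_mem hy]
  refine connectedComponentIn_eq ?_
  refine (isPreconnected_uIcc.image φ hφ.continuousOn).subset_connectedComponentIn
    (mem_image_of_mem _ left_mem_uIcc) ?_ (mem_image_of_mem _ right_mem_uIcc)
  -- A crossing with `s` between the two edges would separate points of the closure of one cell.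
  rintro _ ⟨d, hd, rfl⟩
  refine ⟨hφr ▸ mem_range_self d, fun hmem => ?_⟩
  simp only [mem_iUnion] at hmem
  obtain ⟨s, hs, hsr, hds⟩ := hmem
  have has := notMem_of_mem_privatePart hs hsr hxr
  have hbs := notMem_of_mem_privatePart hs hsr hyr
  exact hC.not_separates hL hs (heC hx) (hfC hy) has hbs
    (hL.separates he.1 hs hsr.symm hφ hinj hφr hds
      (strictly_between_of_mem_uIcc hd (fun h => has (h ▸ hds)) fun h => hbs (h ▸ hds)))

/-- If two cells are separated by no pseudoline but `p`, and both have an edge on `r ≠ p`, then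
the crossing of `r` and `p` is a vertex of each of them. -/
lemma exists_vertex_mem_closure (hL : IsArrangement L) {C P p r g k : Set Plane}
    (hC : IsCell L C) (hP : IsCell L P) (hp : p ∈ L)
    (hCP : ∃ a ∈ C, ∃ b ∈ P, Separates p a b)
    (hsame : ∀ s ∈ L, s ≠ p → ∀ a ∈ C, ∀ b ∈ P, ¬ Separates s a b)
    (hrp : r ≠ p) (hg : IsEdgeOn L r g) (hgC : g ⊆ closure C) (hk : IsEdgeOn L r k)
    (hkP : k ⊆ closure P) : ∃ w ∈ p ∩ r, w ∈ closure C := by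
  obtain ⟨φ, hφ, hinj, hφr⟩ := (hL.isPseudoline r hg.1).exists_param
  obtain ⟨x, hx⟩ := hg.nonempty
  obtain ⟨y, hy⟩ := hk.nonempty
  have hxr := hg.subset_privatePart hx
  have hyr := hk.subset_privatePart hy
  obtain ⟨a, rfl⟩ : x ∈ range φ := hφr ▸ hxr.1
  obtain ⟨b, rfl⟩ : y ∈ range φ := hφr ▸ hyr.1
  obtain ⟨c, hc, o, ho, hco⟩ := hCP
  -- Off `s`, the closure of a cell stays on the side of the cell, so points of the edges may
  -- replace points of the cells.
  have comp : ∀ s ∈ L, s ≠ r →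
      (Separates s (φ a) (φ b) ↔ Separates s c o) := by
    intro s hs hsr
    have hcl := (hL.isPseudoline s hs).isClosed
    rw [Separates, component_eq_of_mem_closure hcl hC.isPreconnected (hC.subset_compl hs) (hgC hx)
      (notMem_of_mem_privatePart hs hsr hxr) hc, component_eq_of_mem_closure hcl hP.isPreconnected
      (hP.subset_compl hs) (hkP hy) (notMem_of_mem_privatePart hs hsr hyr) ho, Separates]
  obtain ⟨d, hd, hdp⟩ : ∃ d ∈ uIcc a b, φ d ∈ p := by
    by_contra! hno
    exact (comp p hp hrp.symm).2 hco (component_eq_of_uIcc hφ hno)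
  have hdr : φ d ∈ r := hφr ▸ mem_range_self d
  refine ⟨φ d, ⟨hdp, hdr⟩, ?_⟩
  have hda : d ≠ a := fun h => notMem_of_mem_privatePart hp hrp.symm hxr (h ▸ hdp)
  -- No pseudoline other than `r` is met before `d`: `p` is met only once, and any other would
  -- separate `C` from `P`. Hence the arc up to `d` stays in the edge `g`.
  have hsub : φ '' (uIcc a d \ {d}) ⊆ g := by
    rw [hg.eq_of_mem hx]
    refine IsPreconnected.subset_connectedComponentIn (IsPreconnected.image ?_ _ hφ.continuousOn)
      (mem_image_of_mem _ ⟨left_mem_uIcc, hda.symm⟩) ?_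
    · rcases le_total a d with h | h
      · rw [uIcc_of_le h, Icc_sdiff_right]
        exact isPreconnected_Ico
      · rw [uIcc_of_ge h, Icc_sdiff_left]
        exact isPreconnected_Ioc
    · rintro _ ⟨t, ⟨ht, htd⟩, rfl⟩
      refine ⟨hφr ▸ mem_range_self t, fun hmem => ?_⟩
      simp only [mem_iUnion] at hmem
      obtain ⟨s, hs, hsr, hts⟩ := hmem
      by_cases hsp : s = p
      · rw [hsp] at hts
        obtain ⟨v, hv⟩ := hL.inter_eq p hp r hg.1 hrp.symm
        have h₁ : φ t = v := mem_singleton_iff.1 (hv ▸ ⟨hts, hφr ▸ mem_range_self t⟩)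
        have h₂ : φ d = v := mem_singleton_iff.1 (hv ▸ ⟨hdp, hdr⟩)
        exact htd (hinj (h₁.trans h₂.symm))
      · refine hsame s hs hsp c hc o ho ((comp s hs hsr).1 ?_)
        refine hL.separates hg.1 hs hsr.symm hφ hinj hφr hts (strictly_between_of_mem_uIcc
          (uIcc_subset_uIcc_left hd ht) ?_ ?_)
        · exact fun h => notMem_of_mem_privatePart hs hsr hxr (h ▸ hts)
        · exact fun h => notMem_of_mem_privatePart hs hsr hyr (h ▸ hts)
  refine closure_minimal (hsub.trans hgC) isClosed_closure ?_
  refine image_closure_subset_closure_image hφ (mem_image_of_mem _ ?_)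
  rcases lt_or_gt_of_ne hda with h | h
  · rw [uIcc_of_ge h.le, Icc_sdiff_left, closure_Ioc h.ne]
    exact left_mem_Icc.2 h.le
  · rw [uIcc_of_le h.le, Icc_sdiff_right, closure_Ico h.ne]
    exact right_mem_Icc.2 h.le

/-! ### Counting vertices and edges -/

/-- Among three points of a real line some point is between the two others, in whichever order. -/
lemma exists_between_of_pairwise_ne {a b c : ℝ} (hab : a ≠ b) (hac : a ≠ c) (hbc : b ≠ c) :
    (a < b ∧ b < c ∨ c < b ∧ b < a) ∨ (b < a ∧ a < c ∨ c < a ∧ a < b) ∨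
      (a < c ∧ c < b ∨ b < c ∧ c < a) := by
  grind

/-- A cell does not have vertices on `p` with three different pseudolines. -/
lemma IsCell.not_three_vertices (hL : IsArrangement L) (hs : IsSimple L) {C p : Set Plane}
    (hC : IsCell L C) (hp : p ∈ L) {r₁ r₂ r₃ : Set Plane} (h₁ : r₁ ∈ L) (h₂ : r₂ ∈ L)
    (h₃ : r₃ ∈ L) (n₁ : r₁ ≠ p) (n₂ : r₂ ≠ p) (n₃ : r₃ ≠ p) (h₁₂ : r₁ ≠ r₂) (h₁₃ : r₁ ≠ r₃)
    (h₂₃ : r₂ ≠ r₃) (w₁ : ∃ w ∈ p ∩ r₁, w ∈ closure C) (w₂ : ∃ w ∈ p ∩ r₂, w ∈ closure C)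
    (w₃ : ∃ w ∈ p ∩ r₃, w ∈ closure C) : False := by
  obtain ⟨φ, hφ, hinj, hφp⟩ := (hL.isPseudoline p hp).exists_param
  have notMem : ∀ {r s : Set Plane} {w : Plane}, r ∈ L → s ∈ L → r ≠ p → s ≠ p → r ≠ s →
      w ∈ p ∩ r → w ∉ s := fun hr hs' nr ns hrs hw hws =>
    (hs _ hp _ hr _ hs' nr.symm ns.symm hrs).subset ⟨hw, hws⟩
  -- Simplicity keeps the two outer vertices off the middle pseudoline `s`, which therefore
  -- separates them.
  have mid : ∀ {r s t : Set Plane} {a b c : ℝ}, r ∈ L → s ∈ L → t ∈ L → r ≠ p → s ≠ p → t ≠ p →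
      r ≠ s → s ≠ t → φ a ∈ p ∩ r → φ b ∈ p ∩ s → φ c ∈ p ∩ t → φ a ∈ closure C →
      φ c ∈ closure C → ¬ (a < b ∧ b < c ∨ c < b ∧ b < a) :=
    fun hr hs' ht nr ns nt hrs hst ha hb hc haC hcC hbet =>
      hC.not_separates hL hs' haC hcC (notMem hr hs' nr ns hrs ha) (notMem ht hs' nt ns hst.symm hc)
        (hL.separates hp hs' ns.symm hφ hinj hφp hb.2 hbet)
  obtain ⟨x₁, m₁, c₁⟩ := w₁
  obtain ⟨x₂, m₂, c₂⟩ := w₂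
  obtain ⟨x₃, m₃, c₃⟩ := w₃
  obtain ⟨a, rfl⟩ : x₁ ∈ range φ := hφp ▸ m₁.1
  obtain ⟨b, rfl⟩ : x₂ ∈ range φ := hφp ▸ m₂.1
  obtain ⟨c, rfl⟩ : x₃ ∈ range φ := hφp ▸ m₃.1
  have hab : a ≠ b := fun h => notMem h₁ h₂ n₁ n₂ h₁₂ m₁ (h ▸ m₂.2)
  have hac : a ≠ c := fun h => notMem h₁ h₃ n₁ n₃ h₁₃ m₁ (h ▸ m₃.2)
  have hbc : b ≠ c := fun h => notMem h₂ h₃ n₂ n₃ h₂₃ m₂ (h ▸ m₃.2)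
  rcases exists_between_of_pairwise_ne hab hac hbc with h | h | h
  · exact mid h₁ h₂ h₃ n₁ n₂ n₃ h₁₂ h₂₃ m₁ m₂ m₃ c₁ c₃ h
  · exact mid h₂ h₁ h₃ n₂ n₁ n₃ h₁₂.symm h₁₃ m₂ m₁ m₃ c₂ c₃ h
  · exact mid h₁ h₃ h₂ n₁ n₃ n₂ h₁₃ h₂₃.symm m₁ m₃ m₂ c₁ c₂ h

/-- If every pseudoline is adjacent to the cell `P`, then a cell that shares an edge with `P` and
lies on the other side of it does not have exactly four edges. -/
lemma numEdges_ne_four (hL : IsArrangement L) (hs : IsSimple L) {C P p e : Set Plane}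
    (hC : IsCell L C) (hP : IsCell L P) (hadj : ∀ q ∈ L, IsAdjacent L q P) (he : IsEdgeOn L p e)
    (heC : e ⊆ closure C) (heP : e ⊆ closure P) (hCP : ∃ a ∈ C, ∃ b ∈ P, Separates p a b) :
    numEdges L C ≠ 4 := by
  intro h4
  obtain ⟨x, hx⟩ := he.nonempty
  have hxp := he.subset_privatePart hx
  -- The point `x` of `e` is off `s` and in both closures, so both cells lie on its side of `s`.
  have hsame : ∀ s ∈ L, s ≠ p → ∀ a ∈ C, ∀ b ∈ P, ¬ Separates s a b := by
    intro s hs hsp a ha b hb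
    have hcl := (hL.isPseudoline s hs).isClosed
    have hxs := notMem_of_mem_privatePart hs hsp hxp
    exact not_not.2 ((component_eq_of_mem_closure hcl hC.isPreconnected (hC.subset_compl hs) (heC hx)
      hxs ha).symm.trans (component_eq_of_mem_closure hcl hP.isPreconnected (hP.subset_compl hs)
      (heP hx) hxs hb))
  have hmem : e ∈ {f | IsEdgeOf L f C} := ⟨⟨p, he⟩, heC⟩
  have h3 : ({f | IsEdgeOf L f C} \ {e}).encard = 3 := by
    have := encard_sdiff_singleton_add_one hmem
    rw [show encard {f | IsEdgeOf L f C} = 4 from h4] at this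
    have h31 : (4 : ℕ∞) = 3 + 1 := by norm_num
    exact ENat.add_left_injective_of_ne_top ENat.one_ne_top (this.trans h31)
  obtain ⟨f₁, f₂, f₃, h₁₂, h₁₃, h₂₃, hf⟩ := encard_eq_three.1 h3
  have key : ∀ f ∈ {f | IsEdgeOf L f C} \ {e}, ∃ r ∈ L, r ≠ p ∧ IsEdgeOn L r f ∧ f ⊆ closure C ∧
      ∃ w ∈ p ∩ r, w ∈ closure C := by
    rintro f ⟨⟨⟨r, hr⟩, hfC⟩, hfe⟩
    have hrp : r ≠ p := by
      rintro rfl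
      exact hfe (hC.edge_unique hL hr he hfC heC)
    obtain ⟨k, hk, -, hkP⟩ := hadj r hr.1
    exact ⟨r, hr.1, hrp, hr, hfC,
      exists_vertex_mem_closure hL hC hP he.1 hCP hsame hrp hr hfC hk hkP⟩
  rw [hf] at key
  obtain ⟨r₁, m₁, n₁, e₁, c₁, w₁⟩ := key f₁ (by simp)
  obtain ⟨r₂, m₂, n₂, e₂, c₂, w₂⟩ := key f₂ (by simp)
  obtain ⟨r₃, m₃, n₃, e₃, c₃, w₃⟩ := key f₃ (by simp)
  refine hC.not_three_vertices hL hs he.1 m₁ m₂ m₃ n₁ n₂ n₃ ?_ ?_ ?_ w₁ w₂ w₃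
  · rintro rfl
    exact h₁₂ (hC.edge_unique hL e₁ e₂ c₁ c₂)
  · rintro rfl
    exact h₁₃ (hC.edge_unique hL e₁ e₃ c₁ c₃)
  · rintro rfl
    exact h₂₃ (hC.edge_unique hL e₂ e₃ c₂ c₃)

end PseudoArr

theorem mainTheorem6 (L : Finset (Set PseudoArr.Plane)) (hL : PseudoArr.IsInIm L)
    (P : Set PseudoArr.Plane) (hP : PseudoArr.IsGeFiveGon L P)
    (e : Set PseudoArr.Plane) (he : PseudoArr.IsEdgeOf L e P)
    (hcrit : ¬ PseudoArr.IsCriticalEdge L e P) :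
    ∃ T, PseudoArr.IsGon L 3 T ∧ PseudoArr.IsEdgeOf L e T := by
  obtain ⟨⟨p, hep⟩, heP⟩ := id he
  obtain ⟨C, hC, heC, hsep⟩ := hep.exists_opposite_cell hL.isArrangement hP.1.1 heP
  have heC' : PseudoArr.IsEdgeOf L e C := ⟨⟨p, hep⟩, heC⟩
  have hCb : Bornology.IsBounded C := by
    by_contra hb
    exact hcrit ⟨he, C, hC, hb, heC'⟩
  obtain ⟨Q, -, hQ⟩ := hL.hasOne
  -- The exceptional polygon supplied by `hasOne` is `P`, since any other polygon has fewer than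
  -- five edges.
  have hPQ : P = Q := by
    by_contra hne
    have h5 := hP.2
    rcases hQ P hP.1 hne with h | h <;> rw [h.2] at h5 <;> revert h5 <;> decide
  have hCP : C ≠ P := by
    rintro rfl
    obtain ⟨a, ha, b, hb, hab⟩ := hsep
    have hCp := hC.subset_compl hep.1
    exact hC.not_separates hL.isArrangement hep.1 (subset_closure ha) (subset_closure hb) (hCp ha)
      (hCp hb) hab
  rcases hQ C ⟨hC, hCb⟩ (hPQ ▸ hCP) with h | h
  · exact ⟨C, h, heC'⟩
  · exact absurd h.2 (PseudoArr.numEdges_ne_four hL.isArrangement hL.isSimple hC hP.1.1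
      (hL.adjacent P hP) hep heC heP hsep)
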